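/- The Evacuation Problem (\textsf{EP}) is NP-hard. Definitions. Let $P$ be a finite set of people, $T=\{0,\dots,t_{\max}\}$ the time points. A building graph is $G=\langle V,E,EX,c,d\rangle$ with $V$ finite, $E\subseteq V\times V$, exits $EX\subsetneq V$, and capacity and travel-time functions $c,d:V\cup E\to\mathbb Z$ such that $d(v)=0$ for $v\in V$ and $c(v)\ge|P|$ for $v\in EX$. A state is a map $P\to V\cup E$; $s_0$ is the state at time $0$. A weak evacuation schedule (WES) is a map $w$ from $T$ to states with $w(0)=s_0$ such that, for every $p\in P$, writing $w_p(t)=w(t)(p)$: (1) if $w_p(t)=v_1\in V$ and $t<t_{\max}$, then $w_p(t+1)$ is $v_1$, or some $e=(v_1,v_2)\in E$, or $v_2$ for some $(v_1,v_2)\in E$; (2) if $w_p(t)=e=(v_1,v_2)\in E$ and $t<t_{\max}$, then $w_p(t+1)\in\{e,v_1,v_2\}$; (3) if $e=(v_1,v_2)\in E$, $w_p(t)=v_1$ and $w_p(t+k)=v_2$ with $k\ge 0$, then $d(e)\le k$; (4) if $w_p(t')\in EX$ and $t'<t''\le t_{\max}$, then $w_p(t'')=w_p(t')$. A strong evacuation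 schedule (SES) is a WES in which, at each time, each $x\in V\cup E$ holds at most $c(x)$ people, and in which all people are at exits at time $t_{\max}$. A behavior model $\beta$ assigns to each SES a probability distribution on the finite set of WESs. For $D\le t_{\max}$ let $N_w(D)$ be the number of people at an exit at time $D$ under $w$, and $\mathbb E[N_{es}(D)]=\sum_{w}\beta(es)(w)\,N_w(D)$. \textsf{EP}: given $G$, $P$, $t_{\max}$, $s_0$, $\beta$ and a deadline $D\le t_{\max}$, find an SES $es$ that maximizes $\mathbb E[N_{es}(D)]$, or report that there is no SES. The sets $V,P,T$ are given explicitly, capacities and travel times in binary, and $\beta$ (with rational probabilities) is given by a program, a parameter string and a unary bound on its running time: on the parameter and any SES $es$ the program outputs, within the bound, $\beta(es)$ as a list of WESs with their probabilities. Theorem. \textsf{EP} is NP-hard: for every language $L$ in NP, membership in $L$ can be decided in polynomial time given an oracle that returns correct answers to instances of \textsf{EP}. In fact one query suffices: an instance of \textsf{EP} can be computed from $x$ in polynomial time such that, from $x$ and any correct answer to this instance, a program decides whether $x\in L$ in time polynomial in $|x|$. -/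

import Mathlib

/-! ## A machine model with a step count

Deterministic programs over finitely many registers. Each register holds a bit string that is used
as a stack: an elementary step pushes one bit, pops one bit or inspects the top bit of one register.
Two registers simulate one tape of a Turing machine and conversely, with constant overhead per step,
so that polynomial time in this model is polynomial time on multitape Turing machines. -/

namespace Evac

/-- Programs. -/
inductive Prog where
  | skip
  | push (r : ℕ) (b : Bool)
  | pop (r : ℕ)
  | seq (p q : Prog)
  /-- Inspect register `r`: run `pn` if it is empty, `pf` if its top is `false`, `pt` if its top
  is `true` (the register itself is not changed). -/
  | branch (r : ℕ) (pn pf pt : Prog)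
  /-- Repeat `p` as long as register `r` is not empty. -/
  | loop (r : ℕ) (p : Prog)

/-- Contents of the registers; the top of a register is the head of the list. -/
abbrev Store := ℕ → List Bool

/-- `p.Exec s s' t`: started on the store `s`, the program `p` halts with the store `s'` after
exactly `t` steps. -/
inductive Prog.Exec : Prog → Store → Store → ℕ → Prop where
  | skip (s : Store) : Prog.Exec .skip s s 1
  | push (r : ℕ) (b : Bool) (s : Store) :
      Prog.Exec (.push r b) s (Function.update s r (b :: s r)) 1
  | pop (r : ℕ) (s : Store) : Prog.Exec (.pop r) s (Function.update s r (s r).tail) 1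
  | seq {p q : Prog} {s s' s'' : Store} {a b : ℕ} :
      Prog.Exec p s s' a → Prog.Exec q s' s'' b → Prog.Exec (.seq p q) s s'' (a + b)
  | branchNil {r : ℕ} {pn pf pt : Prog} {s s' : Store} {a : ℕ} :
      s r = [] → Prog.Exec pn s s' a → Prog.Exec (.branch r pn pf pt) s s' (a + 1)
  | branchFalse {r : ℕ} {pn pf pt : Prog} {s s' : Store} {a : ℕ} :
      (s r).head? = some false → Prog.Exec pf s s' a →
        Prog.Exec (.branch r pn pf pt) s s' (a + 1)
  | branchTrue {r : ℕ} {pn pf pt : Prog} {s s' : Store} {a : ℕ} :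
      (s r).head? = some true → Prog.Exec pt s s' a →
        Prog.Exec (.branch r pn pf pt) s s' (a + 1)
  | loopDone {r : ℕ} {p : Prog} {s : Store} : s r = [] → Prog.Exec (.loop r p) s s 1
  | loopStep {r : ℕ} {p : Prog} {s s' s'' : Store} {a b : ℕ} :
      s r ≠ [] → Prog.Exec p s s' a → Prog.Exec (.loop r p) s' s'' b →
        Prog.Exec (.loop r p) s s'' (a + b + 1)

/-- The initial store: the `i`-th input in register `i`, all other registers empty. -/
def initStore (inputs : List (List Bool)) : Store := fun r => inputs.getD r []

/-- On the given inputs, `p` halts within `T` steps with `z` in register `0`. -/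
def Prog.OutputsWithin (p : Prog) (inputs : List (List Bool)) (z : List Bool) (T : ℕ) : Prop :=
  ∃ (s : Store) (t : ℕ), t ≤ T ∧ p.Exec (initStore inputs) s t ∧ s 0 = z

/-! ## Polynomial time, NP, and NP-hardness of search problems -/

/-- `f` is computable in polynomial time. -/
def PolyTime (f : List Bool → List Bool) : Prop :=
  ∃ (p : Prog) (q : Polynomial ℕ), ∀ x, p.OutputsWithin [x] (f x) (q.eval x.length)

/-- A function of two strings that is computable in polynomial time. -/
def PolyTime₂ (f : List Bool → List Bool → List Bool) : Prop :=
  ∃ (p : Prog) (q : Polynomial ℕ), ∀ x y,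
    p.OutputsWithin [x, y] (f x y) (q.eval (x.length + y.length))

/-- The class NP: membership has polynomial-size certificates checkable in polynomial time. -/
def InNP (L : Language Bool) : Prop :=
  ∃ (verify : List Bool → List Bool → List Bool) (q : Polynomial ℕ), PolyTime₂ verify ∧
    ∀ x, x ∈ L ↔ ∃ c : List Bool, c.length ≤ q.eval x.length ∧ verify x c = [true]

/-- A search problem: instances, their encoding as bit strings, and the correct answers. -/
structure SearchProblem where
  Inst : Type
  encode : Inst → List Bool
  IsAnswer : Inst → List Bool → Prop

/-- A search problem is NP-hard if every language `L` in NP can be decided in polynomial time with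
access to correct answers for it. We demand this with a single query: an instance `R x` is computed
from `x` in polynomial time, it has a correct answer, and from `x` and any correct answer `y`
to `R x` a program decides `x ∈ L` in time polynomial in the length of `x`. -/
def SearchProblem.NPHard (Q : SearchProblem) : Prop :=
  ∀ L : Language Bool, InNP L →
    ∃ (R : List Bool → Q.Inst) (p : Prog) (q : Polynomial ℕ),
      PolyTime (fun x => Q.encode (R x)) ∧
      ∀ x, (∃ y, Q.IsAnswer (R x) y) ∧
        ∀ y, Q.IsAnswer (R x) y →
          ∃ z, p.OutputsWithin [x, y] z (q.eval x.length) ∧ (x ∈ L ↔ z = [true])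

/-! ## The evacuation framework -/

/-- Building graphs for the set `P` of people, on the vertex set `V`. The functions `c` (capacity)
and `d` (travel time) are defined on `V ∪ E`. -/
structure BuildingGraph (V P : Type) [Fintype V] [Fintype P] where
  E : Finset (V × V)
  EX : Finset V
  EX_ssubset : EX ⊂ Finset.univ
  c : V ⊕ E → ℤ
  d : V ⊕ E → ℤ
  d_vertex : ∀ v : V, d (.inl v) = 0
  c_exit : ∀ v ∈ EX, (Fintype.card P : ℤ) ≤ c (.inl v)

section Framework

variable {V P : Type} [Fintype V] [Fintype P]

/-- `V ∪ E`. -/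
abbrev BuildingGraph.Loc (G : BuildingGraph V P) : Type := V ⊕ G.E

/-- A state says where each person is. -/
abbrev BuildingGraph.State (G : BuildingGraph V P) : Type := P → G.Loc

/-- `w` maps the time points `0, …, tmax` to states and is a weak evacuation schedule with
initial state `s₀`. -/
structure IsWES (G : BuildingGraph V P) (s₀ : G.State) {tmax : ℕ}
    (w : Fin (tmax + 1) → G.State) : Prop where
  start : w 0 = s₀
  from_vertex : ∀ (p : P) (t : Fin tmax) (v₁ : V), w t.castSucc p = .inl v₁ →
    w t.succ p = .inl v₁ ∨
    (∃ e : G.E, e.1.1 = v₁ ∧ w t.succ p = .inr e) ∨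
    (∃ e : G.E, e.1.1 = v₁ ∧ w t.succ p = .inl e.1.2)
  from_edge : ∀ (p : P) (t : Fin tmax) (e : G.E), w t.castSucc p = .inr e →
    w t.succ p = .inr e ∨ w t.succ p = .inl e.1.1 ∨ w t.succ p = .inl e.1.2
  travel : ∀ (p : P) (e : G.E) (t t' : Fin (tmax + 1)), t ≤ t' →
    w t p = .inl e.1.1 → w t' p = .inl e.1.2 → G.d (.inr e) ≤ (t'.val : ℤ) - (t.val : ℤ)
  exit_stays : ∀ (p : P) (t t' : Fin (tmax + 1)), t < t' →
    ∀ v ∈ G.EX, w t p = .inl v → w t' p = .inl v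

/-- Strong evacuation schedules: capacities of vertices and edges are respected, and everybody is
at an exit at time `tmax`. -/
structure IsSES (G : BuildingGraph V P) (s₀ : G.State) {tmax : ℕ}
    (w : Fin (tmax + 1) → G.State) : Prop extends IsWES G s₀ w where
  capacity : ∀ (t : Fin (tmax + 1)) (l : G.Loc), ({p | w t p = l}.ncard : ℤ) ≤ G.c l
  all_out : ∀ p : P, ∃ v ∈ G.EX, w (Fin.last tmax) p = .inl v

/-- The set of weak evacuation schedules. -/
abbrev WES (G : BuildingGraph V P) (s₀ : G.State) (tmax : ℕ) : Type :=
  {w : Fin (tmax + 1) → G.State // IsWES G s₀ w}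

/-- The set of strong evacuation schedules. -/
abbrev SES (G : BuildingGraph V P) (s₀ : G.State) (tmax : ℕ) : Type :=
  {w : Fin (tmax + 1) → G.State // IsSES G s₀ w}

noncomputable instance (G : BuildingGraph V P) (s₀ : G.State) (tmax : ℕ) :
    Fintype (WES G s₀ tmax) := Fintype.ofFinite _

/-- A behavior model assigns to each strong schedule a probability distribution on the weak
schedules. -/
abbrev BehaviorModel (G : BuildingGraph V P) (s₀ : G.State) (tmax : ℕ) : Type :=
  SES G s₀ tmax → stdSimplex ℝ (WES G s₀ tmax)

/-- The number of people evacuated by time `D`. -/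
noncomputable def numEvacuated (G : BuildingGraph V P) {tmax : ℕ}
    (w : Fin (tmax + 1) → G.State) (D : Fin (tmax + 1)) : ℕ :=
  {p : P | ∃ v ∈ G.EX, w D p = .inl v}.ncard

/-- The expected number of people evacuated by time `D` when the people are told to follow
`es`. -/
noncomputable def expectedEvacuated {G : BuildingGraph V P} {s₀ : G.State} {tmax : ℕ}
    (β : BehaviorModel G s₀ tmax) (D : Fin (tmax + 1)) (es : SES G s₀ tmax) : ℝ :=
  ∑ w : WES G s₀ tmax, (β es).1 w * (numEvacuated G w.1 D : ℝ)

end Framework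

/-- Evacuation frameworks with vertex set `V`, people `P` and time points `0, …, tmax`. -/
structure EvacuationFramework (V P : Type) [Fintype V] [Fintype P] (tmax : ℕ) where
  G : BuildingGraph V P
  s₀ : G.State
  β : BehaviorModel G s₀ tmax

/-! ## Encodings as bit strings

All encodings are uniquely decodable, given the numbers of vertices, people and time points. Sizes
of the explicitly given sets (vertices, people, time points), their elements, and step bounds are
in unary; capacities, travel times and probabilities are in binary. -/

def encUnary (k : ℕ) : List Bool := List.replicate k true ++ [false]

def encString (a : List Bool) : List Bool := a.flatMap (fun b => [true, b]) ++ [false]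

/-- Binary, least significant bit first. -/
def encNat (k : ℕ) : List Bool := encString k.bits

def encInt (z : ℤ) : List Bool := decide (z < 0) :: encNat z.natAbs

/-- A nonnegative rational number as a reduced fraction. -/
def encRat (q : ℚ≥0) : List Bool := encNat q.num ++ encNat q.den

def Prog.enc : Prog → List Bool
  | .skip => [false, false, false]
  | .push r b => [false, false, true] ++ encUnary r ++ [b]
  | .pop r => [false, true, false] ++ encUnary r
  | .seq p q => [false, true, true] ++ p.enc ++ q.enc
  | .branch r pn pf pt => [true, false, false] ++ encUnary r ++ pn.enc ++ pf.enc ++ pt.enc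
  | .loop r p => [true, false, true] ++ encUnary r ++ p.enc

/-- Concatenation of `f 0, …, f (k - 1)`. -/
def concatFin {k : ℕ} (f : Fin k → List Bool) : List Bool := (List.ofFn f).flatten

section Encodings

variable {n m : ℕ}

/-- For each vertex whether it is an exit, and its capacity; then the adjacency matrix, with
capacity and travel time of each edge. -/
def BuildingGraph.enc (G : BuildingGraph (Fin n) (Fin m)) : List Bool :=
  concatFin (fun v => decide (v ∈ G.EX) :: encInt (G.c (.inl v))) ++
  concatFin (fun u => concatFin (fun v =>
    if h : (u, v) ∈ G.E then
      true :: (encInt (G.c (.inr ⟨(u, v), h⟩)) ++ encInt (G.d (.inr ⟨(u, v), h⟩)))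
    else [false]))

def encLoc {G : BuildingGraph (Fin n) (Fin m)} : G.Loc → List Bool
  | .inl v => false :: encUnary v.val
  | .inr e => true :: (encUnary e.1.1.val ++ encUnary e.1.2.val)

def encState {G : BuildingGraph (Fin n) (Fin m)} (s : G.State) : List Bool :=
  concatFin (fun p => encLoc (s p))

def encSchedule {G : BuildingGraph (Fin n) (Fin m)} {tmax : ℕ}
    (w : Fin (tmax + 1) → G.State) : List Bool :=
  concatFin (fun t => encState (w t))

/-- A finite list of weak schedules with probabilities. -/
def encDistribution {G : BuildingGraph (Fin n) (Fin m)} {s₀ : G.State} {tmax : ℕ}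
    (l : List (WES G s₀ tmax × ℚ≥0)) : List Bool :=
  l.flatMap (fun a => true :: (encSchedule a.1.1 ++ encRat a.2)) ++ [false]

open Classical in
/-- The finite succinct description of a behavior model that is part of the input: a program with
a parameter string and a bound on its running time. On the parameter and any strong schedule `es`,
the program outputs within the bound the distribution `β es`, as a list of weak schedules with
their probabilities. -/
def Describes {G : BuildingGraph (Fin n) (Fin m)} {s₀ : G.State} {tmax : ℕ}
    (prog : Prog) (param : List Bool) (bound : ℕ) (β : BehaviorModel G s₀ tmax) : Prop :=
  ∀ es : SES G s₀ tmax, ∃ l : List (WES G s₀ tmax × ℚ≥0),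
    prog.OutputsWithin [param, encSchedule es.1] (encDistribution l) bound ∧
    ∀ w, (β es).1 w = ((((l.filter (fun a => a.1 = w)).map Prod.snd).sum : ℚ≥0) : ℝ)

end Encodings

/-! ## The evacuation problem -/

/-- Instances of EP: an evacuation framework, whose behavior model is given by a program, and
a deadline `D ≤ tmax`. -/
structure EPInstance where
  n : ℕ
  m : ℕ
  tmax : ℕ
  F : EvacuationFramework (Fin n) (Fin m) tmax
  D : Fin (tmax + 1)
  prog : Prog
  param : List Bool
  bound : ℕ
  describes : Describes prog param bound F.β

def EPInstance.enc (I : EPInstance) : List Bool :=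
  encUnary I.n ++ encUnary I.m ++ encUnary I.tmax ++ encUnary I.D.val ++
  I.F.G.enc ++ encState I.F.s₀ ++ I.prog.enc ++ encString I.param ++ encUnary I.bound

/-- The strong schedule `es` maximizes the expected number of people evacuated by `D`. -/
def EPInstance.IsOptimal (I : EPInstance) (es : SES I.F.G I.F.s₀ I.tmax) : Prop :=
  ∀ es' : SES I.F.G I.F.s₀ I.tmax,
    expectedEvacuated I.F.β I.D es' ≤ expectedEvacuated I.F.β I.D es

/-- The correct answers: any optimal strong schedule, or the report that there is no strong
schedule at all. -/
def EPInstance.IsAnswer (I : EPInstance) (y : List Bool) : Prop :=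
  (∃ es : SES I.F.G I.F.s₀ I.tmax, I.IsOptimal es ∧ y = true :: encSchedule es.1) ∨
  (IsEmpty (SES I.F.G I.F.s₀ I.tmax) ∧ y = [false])

/-- The Evacuation Problem. -/
def EP : SearchProblem where
  Inst := EPInstance
  encode := EPInstance.enc
  IsAnswer := EPInstance.IsAnswer

end Evac

namespace Evac

/-! ## Running programs within a time bound -/

/-! The hardness comes from the behavior model: it is given by a program, and this program may be an
NP verifier. Let `N` bound the length of certificates for `x`. A single person in a one-edge
building encodes a bit at each time before leaving, by standing at the start (`false`) or on the
edge (`true`). With `N + 1` as the last time, the strong schedules spell exactly the strings of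
length at most `N` (`length_spelled_le`, `exists_ses_spelled_eq`).

Told to follow such a schedule, the person surely waits at the start, and leaves at the last moment
if and only if the verifier accepts the spelled string. With the last time as deadline, the
expectation is thus 1 or 0 (`expectedEvacuated_testModel`), and an optimal schedule spells a
certificate whenever there is one (`certificateInstance_isAnswer`). One more run of the verifier on
the spelled string decides membership.

The rest is programming. The behavior program must decode a schedule, run the verifier in clean
registers while remembering the number of time points, and write a distribution
(`behavior_outputsWithin`); `Exec.splice` protects the remembered number. The instance must be
written in polynomial time (`polyTime_instance_shape`): only the parameter and three unary numbers
in it depend on `x`. -/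

/-- Started on `s`, the program `p` halts with the store `s'` within `T` steps. -/
def Prog.Runs (p : Prog) (s s' : Store) (T : ℕ) : Prop := ∃ t ≤ T, p.Exec s s' t

namespace Prog

lemma Runs.mono {p : Prog} {s s' : Store} {T T' : ℕ} (h : p.Runs s s' T) (hT : T ≤ T') :
    p.Runs s s' T' := by
  obtain ⟨t, ht, h⟩ := h
  exact ⟨t, ht.trans hT, h⟩

lemma Runs.congr {p : Prog} {s s' u u' : Store} {T T' : ℕ} (h : p.Runs u u' T) (hs : s = u)
    (hs' : u' = s') (hT : T ≤ T') : p.Runs s s' T' := by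
  subst hs hs'
  exact h.mono hT

lemma runs_skip (s : Store) : Prog.skip.Runs s s 1 := ⟨1, le_rfl, .skip s⟩

lemma runs_push (r : ℕ) (b : Bool) (s : Store) :
    (Prog.push r b).Runs s (Function.update s r (b :: s r)) 1 := ⟨1, le_rfl, .push r b s⟩

lemma runs_pop (r : ℕ) (s : Store) :
    (Prog.pop r).Runs s (Function.update s r (s r).tail) 1 := ⟨1, le_rfl, .pop r s⟩

lemma Runs.seq {p q : Prog} {s s' s'' : Store} {a b : ℕ} (hp : p.Runs s s' a)
    (hq : q.Runs s' s'' b) : (Prog.seq p q).Runs s s'' (a + b) := by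
  obtain ⟨t, ht, hp⟩ := hp
  obtain ⟨u, hu, hq⟩ := hq
  exact ⟨t + u, by omega, .seq hp hq⟩

lemma runs_branch_nil {r : ℕ} {pn pf pt : Prog} {s s' : Store} {a : ℕ} (hr : s r = [])
    (h : pn.Runs s s' a) : (Prog.branch r pn pf pt).Runs s s' (a + 1) := by
  obtain ⟨t, ht, h⟩ := h
  exact ⟨t + 1, by omega, .branchNil hr h⟩

lemma runs_branch_cons {r : ℕ} {pn pf pt : Prog} {s s' : Store} {a : ℕ} {b : Bool}
    {l : List Bool} (hr : s r = b :: l) (h : (if b then pt else pf).Runs s s' a) :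
    (Prog.branch r pn pf pt).Runs s s' (a + 1) := by
  obtain ⟨t, ht, h⟩ := h
  cases b
  · exact ⟨t + 1, by omega, .branchFalse (by simp [hr]) h⟩
  · exact ⟨t + 1, by omega, .branchTrue (by simp [hr]) h⟩

/-- A loop that consumes one item of a list per round, updating an accumulator. -/
lemma runs_loop_foldl {β α : Type*} {r : ℕ} {p : Prog} {T : ℕ} (F : List β → α → Store)
    (step : α → β → α) (hnil : ∀ a, F [] a r = []) (hcons : ∀ x l a, F (x :: l) a r ≠ [])
    (h : ∀ x l a, p.Runs (F (x :: l) a) (F l (step a x)) T) (l : List β) (a : α) :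
    (Prog.loop r p).Runs (F l a) (F [] (l.foldl step a)) (l.length * (T + 1) + 1) := by
  induction l generalizing a with
  | nil => exact ⟨1, by simp, .loopDone (hnil a)⟩
  | cons x l ih =>
    obtain ⟨t, ht, h1⟩ := h x l a
    obtain ⟨u, hu, h2⟩ := ih (step a x)
    refine ⟨t + u + 1, ?_, .loopStep (hcons x l a) h1 h2⟩
    simp only [List.length_cons]
    linarith [ht, hu]

/-- Empty a register. -/
def clear (r : ℕ) : Prog := .loop r (.pop r)

lemma runs_clear (r : ℕ) (s : Store) :
    (clear r).Runs s (Function.update s r []) (2 * (s r).length + 1) := by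
  have := runs_loop_foldl (r := r) (p := .pop r) (T := 1)
    (fun (l : List Bool) (_ : Unit) => Function.update s r l) (fun _ _ => ()) (by simp) (by simp)
    (fun b l _ => (runs_pop r _).congr rfl (by simp) le_rfl) (s r) ()
  exact this.congr (by simp) rfl (by omega)

/-- Push all elements of `l`, so that `l` ends up on top of the register. -/
def pushList (r : ℕ) : List Bool → Prog
  | [] => .skip
  | b :: l => .seq (pushList r l) (.push r b)

lemma runs_pushList (r : ℕ) (l : List Bool) (s : Store) :
    (pushList r l).Runs s (Function.update s r (l ++ s r)) (l.length + 1) := by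
  induction l with
  | nil => exact (runs_skip s).congr rfl (by simp) (by simp)
  | cons b l ih => exact (ih.seq (runs_push r b _)).congr rfl (by simp) (by simp)

/-- Reverse the register `a` onto the register `b`. -/
def move (a b : ℕ) : Prog :=
  .loop a (.seq (.branch a .skip (.push b false) (.push b true)) (.pop a))

lemma runs_move {a b : ℕ} (hab : a ≠ b) (s : Store) :
    (move a b).Runs s (Function.update (Function.update s a []) b ((s a).reverse ++ s b))
      (4 * (s a).length + 1) := by
  have := runs_loop_foldl (r := a)
    (p := .seq (.branch a .skip (.push b false) (.push b true)) (.pop a)) (T := 3)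
    (fun (l : List Bool) (m : List Bool) => Function.update (Function.update s a l) b m)
    (fun m x => x :: m) (by simp [hab]) (by simp [hab])
    (fun x l m => by
      refine ((runs_branch_cons (b := x) (l := l) (by simp [hab]) (a := 1)
        (s' := Function.update (Function.update s a (x :: l)) b (x :: m)) ?_).seq
        (runs_pop a _)).congr rfl ?_ (by norm_num)
      · cases x
        · exact (runs_push b false _).congr rfl (by simp) le_rfl
        · exact (runs_push b true _).congr rfl (by simp) le_rfl
      · rw [Function.update_comm hab]; simp [Function.update_comm hab])
    (s a) (s b)
  refine this.congr (by simp) ?_ (by omega)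
  congr 1
  generalize s b = m
  induction s a generalizing m with
  | nil => rfl
  | cons x l ih => simp [ih]

/-! ### Programs touch only the registers they mention -/

/-- A strict upper bound for the registers occurring in a program. -/
def width : Prog → ℕ
  | .skip => 0
  | .push r _ => r + 1
  | .pop r => r + 1
  | .seq p q => max p.width q.width
  | .branch r pn pf pt => max (r + 1) (max pn.width (max pf.width pt.width))
  | .loop r p => max (r + 1) p.width

/-- The registers below `K` from `s`, the others from `u`. -/
def splice (K : ℕ) (s u : Store) : Store := fun r => if r < K then s r else u r

lemma splice_of_lt {K r : ℕ} (h : r < K) (s u : Store) : splice K s u r = s r := if_pos h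

lemma splice_of_le {K r : ℕ} (h : K ≤ r) (s u : Store) : splice K s u r = u r :=
  if_neg (by omega)

lemma splice_update {K r : ℕ} (h : r < K) (s u : Store) (l : List Bool) :
    splice K (Function.update s r l) u = Function.update (splice K s u) r l := by
  funext i
  by_cases hi : i = r
  · subst hi; simp [splice, h]
  · simp [splice, hi]

/-- A program neither reads nor writes registers from its width on, so their contents can be chosen
freely. This lets the verifier run as if on its initial store while a counter is kept out of its
reach. -/
lemma Exec.splice {p : Prog} {s s' : Store} {t : ℕ} (h : p.Exec s s' t) {K : ℕ}
    (hK : p.width ≤ K) (u : Store) : p.Exec (Prog.splice K s u) (Prog.splice K s' u) t := by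
  induction h with
  | skip s => exact .skip _
  | push r b s =>
    have hr : r < K := hK
    rw [splice_update hr]
    have := Exec.push r b (Prog.splice K s u)
    rwa [splice_of_lt hr] at this
  | pop r s =>
    have hr : r < K := hK
    rw [splice_update hr]
    have := Exec.pop r (Prog.splice K s u)
    rwa [splice_of_lt hr] at this
  | seq _ _ ih1 ih2 =>
    simp only [width, max_le_iff] at hK
    exact .seq (ih1 hK.1) (ih2 hK.2)
  | branchNil h _ ih =>
    simp only [width, max_le_iff] at hK
    exact .branchNil (by rwa [splice_of_lt hK.1]) (ih hK.2.1)
  | branchFalse h _ ih =>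
    simp only [width, max_le_iff] at hK
    exact .branchFalse (by rwa [splice_of_lt hK.1]) (ih hK.2.2.1)
  | branchTrue h _ ih =>
    simp only [width, max_le_iff] at hK
    exact .branchTrue (by rwa [splice_of_lt hK.1]) (ih hK.2.2.2)
  | loopDone h =>
    simp only [width, max_le_iff] at hK
    exact .loopDone (by rwa [splice_of_lt hK.1])
  | loopStep h _ _ ih1 ih2 =>
    have hK' := hK
    simp only [width, max_le_iff] at hK'
    exact .loopStep (by rwa [splice_of_lt hK'.1]) (ih1 hK'.2) (ih2 hK)

/-- A step pushes at most one bit. This bounds the cost of clearing the verifier's output. -/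
lemma Exec.length_le {p : Prog} {s s' : Store} {t : ℕ} (h : p.Exec s s' t) (i : ℕ) :
    (s' i).length ≤ (s i).length + t := by
  induction h with
  | skip s => omega
  | push r b s =>
    by_cases hi : i = r
    · subst hi; simp
    · simp [hi]
  | pop r s =>
    by_cases hi : i = r
    · subst hi; simp; omega
    · simp [hi]
  | loopDone h => omega
  | _ => omega

end Prog

/-! ## Computing polynomials in unary -/

lemma eval_mono_nat (q : Polynomial ℕ) {a b : ℕ} (h : a ≤ b) : q.eval a ≤ q.eval b := by
  rw [Polynomial.eval_eq_sum_range, Polynomial.eval_eq_sum_range]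
  gcongr

lemma foldl_const_add (a : ℕ) (l : List Bool) (m : ℕ) :
    l.foldl (fun m _ => a + m) m = l.length * a + m := by
  induction l generalizing m with
  | nil => simp
  | cons x l ih => simp only [List.foldl_cons, List.length_cons, ih]; ring

namespace Prog

/-- With the register `2` as a unary counter, put a copy of it into the register `j`, using the
register `3`. -/
def copyCounter (j : ℕ) : Prog :=
  .seq (.loop 2 (.seq (.pop 2) (.seq (.push 3 true) (.push j true)))) (move 3 2)

/-- Register `2` is used up while feeding `3` and `j`, then refilled from `3`; the reversal in
`move` does not affect a unary string. -/
lemma runs_copyCounter {j n : ℕ} (hj : 4 ≤ j) {s : Store} (h2 : s 2 = List.replicate n true)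
    (h3 : s 3 = []) (hj0 : s j = []) :
    (copyCounter j).Runs s (Function.update s j (List.replicate n true)) (8 * n + 2) := by
  have h := runs_loop_foldl (r := 2)
    (p := .seq (.pop 2) (.seq (.push 3 true) (.push j true))) (T := 3)
    (fun (l : List Bool) (m : ℕ) => Function.update (Function.update (Function.update s
      2 l) 3 (List.replicate m true)) j (List.replicate m true))
    (fun m _ => 1 + m)
    (fun _ => by simp [show (2 : ℕ) ≠ j by omega])
    (fun _ _ _ => by simp [show (2 : ℕ) ≠ j by omega])
    (fun x l m => ((runs_pop 2 _).seq ((runs_push 3 true _).seq (runs_push j true _))).congr rfl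
      (by
        funext i
        simp only [Function.update_apply, add_comm 1, List.replicate_succ]
        split_ifs <;> first | omega | simp_all) (by norm_num)) (s 2) 0
  rw [foldl_const_add] at h
  refine (h.seq (runs_move (by norm_num) _)).congr ?_ ?_ ?_
  · funext i
    simp only [Function.update_apply]
    split_ifs <;> simp_all
  · funext i
    simp only [Function.update_apply]
    split_ifs <;> first | omega | simp_all
  · simp [h2, show (3 : ℕ) ≠ j by omega]
    omega

end Prog

/-- Monomials can be added in unary to the register `0`; the registers from `4` on serve as
loop counters. -/
lemma exists_prog_monomial (a k : ℕ) : ∃ (p : Prog) (τ : Polynomial ℕ), ∀ (n : ℕ) (s : Store),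
    s 2 = List.replicate n true → s 3 = [] → (∀ r, 4 ≤ r → r < 4 + k → s r = []) →
    p.Runs s (Function.update s 0 (List.replicate (a * n ^ k) true ++ s 0)) (τ.eval n) := by
  induction k with
  | zero =>
    refine ⟨Prog.pushList 0 (List.replicate a true), Polynomial.C (a + 1), fun n s _ _ _ => ?_⟩
    exact (Prog.runs_pushList 0 _ s).congr rfl (by simp) (by simp)
  | succ k ih =>
    obtain ⟨p, τ, hp⟩ := ih
    -- The next power of `n` arises by `n` rounds of the program for the exponent `k`. The fresh
    -- register `4 + k` counts the rounds and ends up empty again.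
    refine ⟨.seq (Prog.copyCounter (4 + k)) (.loop (4 + k) (.seq (.pop (4 + k)) p)),
      8 * Polynomial.X + 2 + (Polynomial.X * (1 + τ + 1) + 1), fun n s h2 h3 hr => ?_⟩
    have hloop := Prog.runs_loop_foldl (r := 4 + k) (p := .seq (.pop (4 + k)) p)
      (T := 1 + τ.eval n)
      (fun (l : List Bool) (m : ℕ) => Function.update (Function.update s (4 + k) l) 0
        (List.replicate m true ++ s 0))
      (fun m _ => a * n ^ k + m) (by simp) (by simp)
      (fun x l m => ((Prog.runs_pop (4 + k) _).seq (hp n _ ?_ ?_ ?_)).congr rfl ?_ le_rfl)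
      (List.replicate n true) 0
    · rw [foldl_const_add] at hloop
      refine ((Prog.runs_copyCounter (by omega) h2 h3 (hr _ (by omega) (by omega))).seq
        (hloop.congr (by simp [show (0 : ℕ) ≠ 4 + k by omega]) rfl le_rfl)).congr rfl ?_ ?_
      · funext i
        have h0 := hr (4 + k) (by omega) (by omega)
        simp only [Function.update_apply]
        split_ifs with h1 h2
        · simp only [List.length_replicate, add_zero]
          congr 2; ring
        · simp_all
        · rfl
      · simp
    · simp [h2, show (2 : ℕ) ≠ 4 + k by omega]
    · simp [h3, show (3 : ℕ) ≠ 4 + k by omega]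
    · intro r hr4 hrk
      have := hr r hr4 (by omega)
      simp [this, show r ≠ 4 + k by omega, show r ≠ 0 by omega]
    · funext i
      simp only [Function.update_apply, List.replicate_add, List.append_assoc]
      split_ifs <;> first | omega | simp_all

/-- The value of a polynomial can be added in unary to the register `0`. -/
lemma exists_prog_polynomial (q : Polynomial ℕ) :
    ∃ (p : Prog) (τ : Polynomial ℕ), ∀ (n : ℕ) (s : Store),
      s 2 = List.replicate n true → (∀ r, 3 ≤ r → s r = []) →
      p.Runs s (Function.update s 0 (List.replicate (q.eval n) true ++ s 0)) (τ.eval n) := by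
  induction q using Polynomial.induction_on' with
  | add f g hf hg =>
    obtain ⟨p, τ, hp⟩ := hf
    obtain ⟨p', τ', hp'⟩ := hg
    refine ⟨.seq p p', τ + τ', fun n s h2 hr => ?_⟩
    refine ((hp n s h2 hr).seq (hp' n _ (by simpa using h2) fun r hr3 => ?_)).congr rfl ?_ (by simp)
    · simpa [Function.update_apply, show r ≠ 0 by omega] using hr r hr3
    · simp only [Function.update_self, Function.update_idem, Polynomial.eval_add,
        add_comm (f.eval n), List.replicate_add, List.append_assoc]
  | monomial k a =>
    obtain ⟨p, τ, hp⟩ := exists_prog_monomial a k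
    refine ⟨p, τ, fun n s h2 hr => ?_⟩
    exact (hp n s h2 (hr 3 le_rfl) fun r h _ => hr r (by omega)).congr rfl (by simp) le_rfl

/-! ## Schedules that spell bit strings

A single person starts at the vertex `0` of a building with the exit `1` and the edge `(0, 1)`.
At each time before leaving, the person is at the vertex `0` or on the edge, which spells a bit. -/

/-- The building with one corridor. -/
def corridor : BuildingGraph (Fin 2) (Fin 1) where
  E := {(0, 1)}
  EX := {1}
  EX_ssubset := by decide
  c := fun _ => 1
  d := Sum.elim (fun _ => 0) (fun _ => 1)
  d_vertex := fun _ => rfl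
  c_exit := fun _ _ => by simp

/-- The only edge of the corridor. -/
def corridorEdge : corridor.E := ⟨(0, 1), by simp [corridor]⟩

lemma corridor_edge_val (e : corridor.E) : e.1 = (0, 1) := by
  simpa [corridor] using e.2

lemma corridor_edge_eq (e : corridor.E) : e = corridorEdge :=
  Subtype.ext (corridor_edge_val e)

lemma corridor_loc_cases (l : corridor.Loc) : l = .inl 0 ∨ l = .inl 1 ∨ l = .inr corridorEdge := by
  rcases l with v | e
  · fin_cases v <;> simp
  · simp [corridor_edge_eq e]

/-- The person starts at the vertex `0`. -/
def corridorStart : corridor.State := fun _ => .inl 0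

/-- Every location is reachable in one step from the vertex `0` and from the edge, and travel time 1
only excludes being at both ends at once. Hence only the start and permanence at the exit are real
constraints. -/
lemma isWES_corridor {tmax : ℕ} {w : Fin (tmax + 1) → corridor.State} (h0 : w 0 = corridorStart)
    (hex : ∀ p t t', t < t' → w t p = .inl 1 → w t' p = .inl 1) :
    IsWES corridor corridorStart w where
  start := h0
  from_vertex p t v hv := by
    fin_cases v
    · rcases corridor_loc_cases (w t.succ p) with h | h | h
      · exact .inl h
      · exact .inr (.inr ⟨corridorEdge, rfl, h⟩)
      · exact .inr (.inl ⟨corridorEdge, rfl, h⟩)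
    · exact .inl (hex p _ _ Fin.castSucc_lt_succ hv)
  from_edge p t e he := by
    rw [corridor_edge_eq e]
    rcases corridor_loc_cases (w t.succ p) with h | h | h
    · exact .inr (.inl h)
    · exact .inr (.inr h)
    · exact .inl h
  travel p e t t' htt' h h' := by
    rw [corridor_edge_val e] at h h'
    have hne : t ≠ t' := by
      rintro rfl
      simp [h] at h'
    have hlt : t.val < t'.val := lt_of_le_of_ne (Fin.le_def.mp htt') (Fin.val_ne_of_ne hne)
    change (1 : ℤ) ≤ _
    omega
  exit_stays p t t' htt' v hv h := by
    obtain rfl : v = 1 := by simpa [corridor] using hv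
    exact hex p t t' htt' h

lemma isSES_corridor {tmax : ℕ} {w : Fin (tmax + 1) → corridor.State}
    (hw : IsWES corridor corridorStart w) (hlast : ∀ p, w (Fin.last tmax) p = .inl 1) :
    IsSES corridor corridorStart w where
  toIsWES := hw
  capacity t l := by
    have : {p | w t p = l}.ncard ≤ 1 := Set.ncard_le_one_of_subsingleton _
    change _ ≤ (1 : ℤ)
    exact_mod_cast this
  all_out p := ⟨1, by simp [corridor], hlast p⟩

/-- The bit spelled by a location; the exit spells nothing. -/
def locBit : corridor.Loc → Option Bool
  | .inl v => if v = 0 then some false else none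
  | .inr _ => some true

/-- The location that spells a given bit. -/
def bitLoc (b : Bool) : corridor.Loc := if b then .inr corridorEdge else .inl 0

lemma locBit_bitLoc (b : Bool) : locBit (bitLoc b) = some b := by cases b <;> rfl

lemma bitLoc_ne_exit (b : Bool) : bitLoc b ≠ .inl 1 := by cases b <;> simp [bitLoc]

/-- The bit string spelled by a schedule from time `1` on. -/
def spelled {tmax : ℕ} (w : Fin (tmax + 1) → corridor.State) : List Bool :=
  (List.ofFn fun t : Fin tmax => w t.succ 0).filterMap locBit

/-- At time `N + 1` the person is at the exit, which spells nothing, so only the times `1, …, N`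
contribute bits. -/
lemma length_spelled_le {N : ℕ} (es : SES corridor corridorStart (N + 1)) :
    (spelled es.1).length ≤ N := by
  obtain ⟨v, hv, h⟩ := es.2.all_out 0
  obtain rfl : v = 1 := by simpa [corridor] using hv
  rw [spelled, List.ofFn_succ', List.concat_eq_append, List.filterMap_append]
  have : locBit (es.1 (Fin.last N).succ 0) = none := by
    rw [Fin.succ_last, h]; rfl
  simp only [List.filterMap_cons, this, List.filterMap_nil, List.append_nil]
  exact (List.length_filterMap_le _ _).trans (by simp)

/-- The position at time `t` of a person who spells `l` and then leaves. -/
def spellingLoc (l : List Bool) : ℕ → corridor.Loc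
  | 0 => .inl 0
  | t + 1 => l[t]?.elim (.inl 1) bitLoc

lemma spellingLoc_exit {c : List Bool} {t : ℕ} : spellingLoc c t = .inl 1 ↔ c.length < t := by
  cases t with
  | zero => simp [spellingLoc]
  | succ t =>
    rcases lt_or_ge t c.length with h | h
    · simp [spellingLoc, bitLoc_ne_exit, h]
    · simp [spellingLoc, List.getElem?_eq_none h]; omega

/-- The person spells `c` and reaches the exit at time `c.length + 1`, which is within the horizon.
-/
lemma exists_ses_spelled_eq {N : ℕ} {c : List Bool} (hc : c.length ≤ N) :
    ∃ es : SES corridor corridorStart (N + 1), spelled es.1 = c := by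
  refine ⟨⟨fun t _ => spellingLoc c t, isSES_corridor (isWES_corridor rfl ?_) ?_⟩, ?_⟩
  · intro _ t t' htt' h
    simp only [spellingLoc_exit] at h ⊢
    exact h.trans htt'
  · intro _
    simp only [spellingLoc_exit, Fin.val_last]
    omega
  · have : (List.ofFn fun t : Fin (N + 1) => spellingLoc c (t.succ : Fin (N + 2))) =
        c.map bitLoc ++ List.replicate (N + 1 - c.length) (.inl 1) := by
      apply List.ext_getElem
      · simp; omega
      · intro i h1 h2
        rcases lt_or_ge i c.length with h | h
        · rw [List.getElem_ofFn]
          simp [spellingLoc, h]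
        · rw [List.getElem_ofFn]
          simp [spellingLoc, h.not_gt, h]
    change List.filterMap locBit (List.ofFn _) = c
    rw [this, List.filterMap_append, List.filterMap_map]
    have h1 : locBit ∘ bitLoc = some := funext locBit_bitLoc
    have h2 : locBit (.inl 1) = none := rfl
    rw [h1]
    simp [h2]

/-! ### Encodings -/

lemma encState_corridor (s : corridor.State) : encState s = encLoc (s 0) := by
  simp [encState, concatFin, List.ofFn_succ]

lemma encSchedule_corridor {tmax : ℕ} (w : Fin (tmax + 1) → corridor.State) :
    encSchedule w = encLoc (w 0 0) ++ (List.ofFn fun t : Fin tmax => w t.succ 0).flatMap encLoc := by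
  simp only [encSchedule, concatFin, encState_corridor, List.ofFn_succ, List.flatten_cons]
  congr 1
  rw [List.flatMap_def, List.map_ofFn]
  rfl

/-! ### A behavior model that rewards accepted strings -/

/-- The person waits at the vertex `0`, and leaves at the last moment if `b` is true. -/
def waiting (N : ℕ) (b : Bool) : WES corridor corridorStart (N + 1) :=
  ⟨fun t _ => if b ∧ t = Fin.last (N + 1) then .inl 1 else .inl 0, isWES_corridor
    (by funext p; simp [corridorStart])
    (fun p t t' htt' h => by
      -- The exit is occupied at the last time only, and no later time exists.
      have : t ≠ Fin.last (N + 1) := (htt'.trans_le (Fin.le_last t')).ne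
      simp [this] at h)⟩

lemma numEvacuated_waiting (N : ℕ) (b : Bool) :
    numEvacuated corridor (waiting N b).1 (Fin.last (N + 1)) = if b then 1 else 0 := by
  cases b
  · simp [numEvacuated, waiting, corridor]
  · simp [numEvacuated, waiting, corridor]

open Classical in
/-- The person leaves in time if and only if the string spelled by the schedule passes the test. -/
noncomputable def testModel (N : ℕ) (test : List Bool → Bool) :
    BehaviorModel corridor corridorStart (N + 1) :=
  fun es => ⟨Pi.single (waiting N (test (spelled es.1))) 1, single_mem_stdSimplex ℝ _⟩

/-- The model is a point mass, so the expectation is the indicator of the test. -/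
lemma expectedEvacuated_testModel (N : ℕ) (test : List Bool → Bool)
    (es : SES corridor corridorStart (N + 1)) :
    expectedEvacuated (testModel N test) (Fin.last (N + 1)) es =
      if test (spelled es.1) then 1 else 0 := by
  classical
  unfold expectedEvacuated testModel
  rw [Finset.sum_eq_single (waiting N (test (spelled es.1)))]
  · rw [numEvacuated_waiting]
    split_ifs <;> simp
  · intro w _ hw
    simp [hw]
  · simp

/-- What follows the schedule in the encoding of a point distribution. -/
def distributionTail : List Bool := encRat 1 ++ [false]

/-- The encoding of the last location of `waiting`. -/
def lastCode (b : Bool) : List Bool := if b then [false, true, false] else [false, false]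

/-- The times `0, …, N` contribute two `false` bits each, and the verdict affects only the last
location. So the output can be written from the verdict and the number `N + 1` alone. -/
lemma encDistribution_waiting (N : ℕ) (b : Bool) :
    encDistribution [(waiting N b, 1)] =
      true :: (List.replicate (2 * (N + 1)) false ++ (lastCode b ++ distributionTail)) := by
  have h : encSchedule (waiting N b).1 = List.replicate (2 * (N + 1)) false ++ lastCode b := by
    have h0 : ∀ k : ℕ, (List.ofFn fun _ : Fin k => [false, false]).flatten =
        List.replicate (2 * k) false := by
      intro k
      induction k with
      | zero => rfl
      | succ k ih => rw [List.ofFn_succ, List.flatten_cons, ih]; rfl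
    simp only [encSchedule, concatFin, encState_corridor]
    rw [List.ofFn_succ', List.concat_eq_append, List.flatten_append]
    congr 1
    · rw [← h0]
      congr 2
      funext t
      simp [waiting, (Fin.castSucc_lt_last t).ne]
      rfl
    · cases b <;> simp [waiting, lastCode] <;> rfl
  simp [encDistribution, h, distributionTail]

/-! ## The programs -/

namespace Prog

/-- Read one location from register `1`; count it in register `K` and push its bit, if any, to
register `K + 1`. -/
def readLoc (K : ℕ) : Prog :=
  .seq (.branch 1 .skip
    (.seq (.pop 1) (.branch 1 .skip (.seq (.pop 1) (.push (K + 1) false))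
      (.seq (.pop 1) (.pop 1))))
    (.seq (.pop 1) (.seq (.pop 1) (.seq (.pop 1) (.seq (.pop 1) (.push (K + 1) true))))))
  (.push K true)

/-- Replace the encoded schedule in register `1` by the string that it spells, and count the
time points after `0` in register `K`. -/
def extract (K : ℕ) : Prog :=
  .seq (.pop 1) (.seq (.pop 1) (.seq (.loop 1 (readLoc K)) (move (K + 1) 1)))

/-- The store during `extract`. -/
def readStore (K : ℕ) (s : Store) (y : List Bool) (k : ℕ) (bs : List Bool) : Store :=
  Function.update (Function.update (Function.update s 1 y) K (List.replicate k true)) (K + 1) bs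

lemma readStore_one {K : ℕ} (hK : 2 ≤ K) (s : Store) (y : List Bool) (k : ℕ) (bs : List Bool) :
    readStore K s y k bs 1 = y := by
  rw [readStore, Function.update_of_ne (by omega), Function.update_of_ne (by omega),
    Function.update_self]

/-- The codes `00` (start), `010` (exit) and `1010` (edge) are told apart by their first two bits.
The edge is the slowest case, with 6 steps before the counter is increased. -/
lemma runs_readLoc {K : ℕ} (hK : 2 ≤ K) (s : Store) (l : corridor.Loc) (y : List Bool) (k : ℕ)
    (bs : List Bool) :
    (readLoc K).Runs (readStore K s (encLoc l ++ y) k bs)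
      (readStore K s y (k + 1) ((locBit l).toList ++ bs)) 7 := by
  have hget : ∀ y, readStore K s y k bs 1 = y := fun y => readStore_one hK s y k bs
  have hpop : ∀ b y, (Prog.pop 1).Runs (readStore K s (b :: y) k bs) (readStore K s y k bs) 1 :=
    fun b y => (runs_pop 1 _).congr rfl (by
      rw [hget]
      funext i
      simp only [readStore, Function.update_apply]
      split_ifs <;> first | omega | simp_all) le_rfl
  have hpush : ∀ b y, (Prog.push (K + 1) b).Runs (readStore K s y k bs)
      (readStore K s y k (b :: bs)) 1 :=
    fun b y => (runs_push (K + 1) b _).congr rfl (by simp [readStore]) le_rfl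
  have hcount : ∀ bs, (Prog.push K true).Runs (readStore K s y k bs)
      (readStore K s y (k + 1) bs) 1 :=
    fun bs => (runs_push K true _).congr rfl (by
      funext i
      simp only [readStore, Function.update_apply, List.replicate_succ]
      split_ifs <;> first | omega | simp_all) le_rfl
  refine Runs.mono (Runs.seq (a := 6) ?_ (hcount _)) (by norm_num)
  rcases corridor_loc_cases l with rfl | rfl | rfl
  · refine Runs.mono (runs_branch_cons (hget _) ((hpop false (false :: y)).seq
      (runs_branch_cons (hget _) ((hpop false y).seq (hpush false y))))) (by norm_num)
  · refine Runs.mono (runs_branch_cons (hget _) ((hpop false (true :: false :: y)).seq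
      (runs_branch_cons (hget _) ((hpop true (false :: y)).seq (hpop false y))))) (by norm_num)
  · refine Runs.mono (runs_branch_cons (hget _) ((hpop true (false :: true :: false :: y)).seq
      ((hpop _ _).seq ((hpop _ _).seq ((hpop _ _).seq (hpush true y)))))) (by norm_num)

lemma initStore_pair (x y : List Bool) :
    initStore [x, y] = Function.update (Function.update (fun _ => []) 0 x) 1 y := by
  funext i
  rcases i with _ | _ | i <;> simp [initStore]

/-- The bits are collected in reverse in register `K + 1`, and `move` puts them in order and empties
that register. What remains is the verifier's initial store below `K` and a counter in `K`, as
`Exec.splice` requires. -/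
lemma runs_extract {K tmax : ℕ} (hK : 2 ≤ K) (x : List Bool)
    {w : Fin (tmax + 1) → corridor.State} (hw : w 0 = corridorStart) :
    (extract K).Runs (initStore [x, encSchedule w])
      (splice K (initStore [x, spelled w])
        (Function.update (fun _ => []) K (List.replicate tmax true)))
      (12 * tmax + 4) := by
  have h1 : (1 : ℕ) ≠ K := by omega
  have h2 : (1 : ℕ) ≠ K + 1 := by omega
  set locs := List.ofFn fun t : Fin tmax => w t.succ 0 with hlocs
  have hlen : locs.length = tmax := by simp [hlocs]
  have henc : encSchedule w = false :: false :: locs.flatMap encLoc := by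
    rw [encSchedule_corridor, hw]; rfl
  set s : Store := Function.update (fun _ => []) 0 x
  have hloop := runs_loop_foldl (r := 1) (p := readLoc K) (T := 7)
    (fun (ls : List corridor.Loc) (a : ℕ × List Bool) =>
      readStore K s (ls.flatMap encLoc) a.1 a.2)
    (fun a l => (a.1 + 1, (locBit l).toList ++ a.2))
    (fun _ => readStore_one hK _ _ _ _)
    (fun l ls a => by
      rw [readStore_one hK]
      rcases l with v | e <;> simp [encLoc])
    (fun l ls a => by simpa using runs_readLoc hK s l (ls.flatMap encLoc) a.1 a.2)
    locs (0, [])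
  have hfold : ∀ (ls : List corridor.Loc) (a : ℕ × List Bool),
      ls.foldl (fun a l => (a.1 + 1, (locBit l).toList ++ a.2)) a =
        (a.1 + ls.length, (ls.filterMap locBit).reverse ++ a.2) := by
    intro ls
    induction ls with
    | nil => simp
    | cons l ls ih =>
      intro a
      rw [List.foldl_cons, ih]
      cases h : locBit l <;> simp [h, add_assoc, add_comm 1]
  rw [hfold] at hloop
  have hsp : locs.filterMap locBit = spelled w := rfl
  have hspl : (spelled w).length ≤ tmax := by
    rw [← hsp, ← hlen]; exact List.length_filterMap_le _ _
  simp only [List.flatMap_nil, zero_add, hlen, hsp, List.append_nil] at hloop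
  -- The first two pops discard the code of the location at time `0`, which is always the start.
  refine ((runs_pop 1 _).seq ((runs_pop 1 _).seq ((hloop.congr ?_ rfl le_rfl).seq
    (runs_move h2.symm _)))).congr rfl ?_ ?_
  · rw [initStore_pair, henc]
    funext i
    simp only [readStore, Function.update_apply, s]
    split_ifs <;> first | omega | simp_all
  · rw [initStore_pair]
    funext i
    simp only [readStore, Function.update_apply, splice, s]
    split_ifs <;> first | omega | simp_all
  · simp [readStore]
    omega

/-- Replace the content of register `0` by the encoding of the point distribution at `waiting`,
whose length is given in register `K`. -/
def emit (K : ℕ) (b : Bool) : Prog :=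
  .seq (clear 0) (.seq (pushList 0 (lastCode b ++ distributionTail))
    (.seq (.loop K (.seq (.pop K) (pushList 0 [false, false]))) (.push 0 true)))

lemma length_distributionTail : distributionTail.length = 7 := by
  simp [distributionTail, encRat, encNat, encString]

/-- A register is a stack, so the output is written from its end: the tail, the repeated codes, then
the list marker. -/
lemma runs_emit {K N : ℕ} (hK : 2 ≤ K) (b : Bool) {s : Store}
    (hs : s K = List.replicate N true) :
    ∃ s', (emit K b).Runs s s' (2 * (s 0).length + 5 * N + 14) ∧
      s' 0 = true :: (List.replicate (2 * N) false ++ (lastCode b ++ distributionTail)) := by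
  have h0 : (0 : ℕ) ≠ K := by omega
  set z := lastCode b ++ distributionTail with hz
  have hloop := runs_loop_foldl (r := K) (p := .seq (.pop K) (pushList 0 [false, false])) (T := 4)
    (fun (l : List Bool) (m : ℕ) => Function.update (Function.update s K l) 0
        (List.replicate (2 * m) false ++ z))
    (fun m _ => 1 + m) (by simp [h0.symm]) (by simp [h0.symm])
    (fun x l m => ((runs_pop K _).seq (runs_pushList 0 _ _)).congr rfl
      (by
        funext i
        simp only [Function.update_apply, add_comm 1, Nat.mul_succ, List.replicate_succ]
        split_ifs <;> first | omega | simp_all) (by simp)) (List.replicate N true) 0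
  rw [foldl_const_add] at hloop
  refine ⟨_, ((runs_clear 0 s).seq ((runs_pushList 0 z _).seq
    ((hloop.congr ?_ rfl le_rfl).seq (runs_push 0 true _)))).mono ?_, ?_⟩
  · funext i
    simp only [Function.update_apply]
    split_ifs <;> simp_all
  · have : z.length ≤ 10 := by
      cases b <;> simp [hz, lastCode, length_distributionTail]
    simp only [List.length_replicate]
    omega
  · simp

/-- Run `A` if register `0` is `[true]`, and `B` otherwise. -/
def ifAccept (A B : Prog) : Prog :=
  .branch 0 B B (.seq (.pop 0) (.branch 0 A B B))

/-- The program that describes a behavior model: extract the string spelled by the schedule, run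
the verifier `v` on it, and announce the verdict. -/
def behavior (v : Prog) (K : ℕ) : Prog :=
  .seq (extract K) (.seq v (ifAccept (emit K true) (emit K false)))

lemma runs_ifAccept_emit {K N : ℕ} (hK : 2 ≤ K) {s : Store} (hs : s K = List.replicate N true) :
    ∃ s', (ifAccept (emit K true) (emit K false)).Runs s s' (2 * (s 0).length + 5 * N + 17) ∧
      s' 0 = true :: (List.replicate (2 * N) false ++
        (lastCode (decide (s 0 = [true])) ++ distributionTail)) := by
  have h0 : K ≠ 0 := by omega
  rcases h : s 0 with _ | ⟨b, l⟩
  · obtain ⟨s', h1, h2⟩ := runs_emit hK false hs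
    exact ⟨s', (runs_branch_nil h h1).mono (by simp [h]), by simpa using h2⟩
  cases b
  · obtain ⟨s', h1, h2⟩ := runs_emit hK false hs
    exact ⟨s', (runs_branch_cons h h1).mono (by simp [h]), by simpa using h2⟩
  -- Comparing with `[true]` requires a look below the top bit. The pop is harmless, since `emit`
  -- clears register `0` anyway.
  set u := Function.update s 0 (s 0).tail with hu
  have hu0 : u 0 = l := by simp [hu, h]
  have huK : u K = List.replicate N true := by simpa [hu, h0] using hs
  rcases l with _ | ⟨b, l⟩
  · obtain ⟨s', h1, h2⟩ := runs_emit hK true huK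
    exact ⟨s', (runs_branch_cons h ((runs_pop 0 s).seq (runs_branch_nil hu0 h1))).mono
      (by simp [hu0]; omega), by simpa using h2⟩
  · obtain ⟨s', h1, h2⟩ := runs_emit hK false huK
    refine ⟨s', (runs_branch_cons h ((runs_pop 0 s).seq (runs_branch_cons (a :=
      2 * (u 0).length + 5 * N + 14) hu0 ?_))).mono
      (by simp [hu0]; omega), by simpa using h2⟩
    cases b <;> exact h1

end Prog

/-! ## The reduction -/

section Reduction

variable {v : Prog} {verify : List Bool → List Bool → List Bool} {qv : Polynomial ℕ}

/-- The bound on the running time of `Prog.behavior`, for inputs of length `n` and certificates of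
length at most `q`, as a polynomial in `n`. -/
noncomputable def behaviorBound (q qv : Polynomial ℕ) : Polynomial ℕ :=
  3 * qv.comp (Polynomial.X + q) + 2 * Polynomial.X + 17 * (q + 1) + 21

lemma eval_behaviorBound (q qv : Polynomial ℕ) (n : ℕ) : (behaviorBound q qv).eval n =
    3 * qv.eval (n + q.eval n) + 2 * n + 17 * (q.eval n + 1) + 21 := by
  simp [behaviorBound, Polynomial.eval_comp]

lemma behavior_outputsWithin
    (hv : ∀ x y, v.OutputsWithin [x, y] (verify x y) (qv.eval (x.length + y.length)))
    (q : Polynomial ℕ) (x : List Bool) {N : ℕ} (hN : N = q.eval x.length)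
    (es : SES corridor corridorStart (N + 1)) :
    (Prog.behavior v (max 2 v.width)).OutputsWithin [x, encSchedule es.1]
      (encDistribution [(waiting N (decide (verify x (spelled es.1) = [true])), 1)])
      ((behaviorBound q qv).eval x.length) := by
  -- The counter lies above the two input registers and all registers of the verifier.
  set K := max 2 v.width with hK
  have hK2 : 2 ≤ K := le_max_left _ _
  set u : Store := Function.update (fun _ => []) K (List.replicate (N + 1) true)
  obtain ⟨s, t, ht, hex, hs⟩ := hv x (spelled es.1)
  have ht' : t ≤ qv.eval (x.length + N) :=
    ht.trans (eval_mono_nat _ (Nat.add_le_add_left (length_spelled_le es) _))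
  have hlen : (s 0).length ≤ x.length + t := by simpa [initStore] using hex.length_le 0
  have hrun : v.Runs (Prog.splice K (initStore [x, spelled es.1]) u) (Prog.splice K s u) t :=
    ⟨t, le_rfl, hex.splice (le_max_right _ _) u⟩
  have hs0 : Prog.splice K s u 0 = s 0 := Prog.splice_of_lt (by omega) _ _
  have hsK : Prog.splice K s u K = List.replicate (N + 1) true := by
    rw [Prog.splice_of_le le_rfl]; simp [u]
  obtain ⟨s', hrun', hs'⟩ := Prog.runs_ifAccept_emit hK2 hsK
  obtain ⟨t', ht', h⟩ := (Prog.runs_extract hK2 x es.2.start).seq (hrun.seq hrun')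
  refine ⟨s', t', ?_, h, ?_⟩
  · rw [eval_behaviorBound, ← hN]
    rw [hs0] at ht'
    omega
  · rw [hs', hs0, hs, encDistribution_waiting]

/-- The instance asking for a schedule that spells a certificate for `x`. -/
noncomputable def certificateInstance
    (hv : ∀ x y, v.OutputsWithin [x, y] (verify x y) (qv.eval (x.length + y.length)))
    (q : Polynomial ℕ) (x : List Bool) : EPInstance where
  n := 2
  m := 1
  tmax := q.eval x.length + 1
  F :=
    { G := corridor
      s₀ := corridorStart
      β := testModel _ fun c => decide (verify x c = [true]) }
  D := Fin.last _
  prog := Prog.behavior v (max 2 v.width)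
  param := x
  bound := (behaviorBound q qv).eval x.length
  describes es := by
    refine ⟨_, behavior_outputsWithin hv q x rfl es, fun w => ?_⟩
    classical
    by_cases hw : waiting _ (decide (verify x (spelled es.1) = [true])) = w
    · subst hw
      simp [testModel]
    · simp [testModel, hw, Ne.symm hw]

/-- For a 0/1 objective, optimal means attaining 1 whenever some schedule does, and the schedules
spell exactly the candidate certificates. The report that no schedule exists is never correct, since
the empty string can be spelled. -/
lemma certificateInstance_isAnswer
    (hv : ∀ x y, v.OutputsWithin [x, y] (verify x y) (qv.eval (x.length + y.length)))
    (q : Polynomial ℕ) (x y : List Bool) :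
    (certificateInstance hv q x).IsAnswer y ↔
      ∃ es : SES corridor corridorStart (q.eval x.length + 1),
        ((∃ c : List Bool, c.length ≤ q.eval x.length ∧ verify x c = [true]) →
          verify x (spelled es.1) = [true]) ∧ y = true :: encSchedule es.1 := by
  have hopt : ∀ es : SES corridor corridorStart (q.eval x.length + 1),
      (certificateInstance hv q x).IsOptimal es ↔
        ((∃ c : List Bool, c.length ≤ q.eval x.length ∧ verify x c = [true]) →
          verify x (spelled es.1) = [true]) := by
    intro es
    have hdef : (certificateInstance hv q x).IsOptimal es ↔
        ∀ es' : SES corridor corridorStart (q.eval x.length + 1),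
          expectedEvacuated (testModel (q.eval x.length) fun c => decide (verify x c = [true]))
            (Fin.last _) es' ≤
          expectedEvacuated (testModel (q.eval x.length) fun c => decide (verify x c = [true]))
            (Fin.last _) es := Iff.rfl
    rw [hdef]
    simp only [expectedEvacuated_testModel, decide_eq_true_eq]
    constructor
    · rintro h ⟨c, hc, hcv⟩
      obtain ⟨es', rfl⟩ := exists_ses_spelled_eq hc
      by_contra hne
      have := h es'
      rw [if_pos hcv, if_neg hne] at this
      linarith
    · intro h es'
      by_cases h' : verify x (spelled es'.1) = [true]
      · rw [if_pos h', if_pos (h ⟨_, length_spelled_le es', h'⟩)]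
      · rw [if_neg h']
        split_ifs <;> norm_num
  constructor
  · rintro (⟨es, he, rfl⟩ | ⟨he, -⟩)
    · exact ⟨es, (hopt es).1 he, rfl⟩
    · obtain ⟨es, -⟩ := exists_ses_spelled_eq (N := q.eval x.length) (c := []) (by simp)
      exact he.elim es
  · rintro ⟨es, he, rfl⟩
    exact .inl ⟨es, (hopt es).2 he, rfl⟩

/-- Decide membership from an optimal schedule: check the certificate that it spells. -/
def Prog.decider (v : Prog) : Prog := .seq (.pop 1) (.seq (extract (max 2 v.width)) v)

/-- The initial pop removes the tag of the answer. The bound for the behavior program is generous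
enough to be reused. -/
lemma decider_outputsWithin
    (hv : ∀ x y, v.OutputsWithin [x, y] (verify x y) (qv.eval (x.length + y.length)))
    (q : Polynomial ℕ) (x : List Bool) {N : ℕ} (hN : N = q.eval x.length)
    (es : SES corridor corridorStart (N + 1)) :
    v.decider.OutputsWithin [x, true :: encSchedule es.1] (verify x (spelled es.1))
      ((behaviorBound q qv).eval x.length) := by
  set K := max 2 v.width with hK
  have hK2 : 2 ≤ K := le_max_left _ _
  obtain ⟨s, t, ht, hex, hs⟩ := hv x (spelled es.1)
  have ht' : t ≤ qv.eval (x.length + N) :=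
    ht.trans (eval_mono_nat _ (Nat.add_le_add_left (length_spelled_le es) _))
  obtain ⟨t', ht', h⟩ := ((Prog.runs_pop 1 (initStore [x, true :: encSchedule es.1])).congr rfl
    (by simp [Prog.initStore_pair]) le_rfl).seq
    ((Prog.runs_extract hK2 x es.2.start).seq ⟨t, le_rfl, hex.splice (le_max_right _ _) _⟩)
  refine ⟨_, t', ?_, h, ?_⟩
  · rw [eval_behaviorBound, ← hN]
    omega
  · rw [Prog.splice_of_lt (by omega), hs]

end Reduction

/-! ### Computing the instance -/

/-- Move the input `x` to register `1`, reversed, and its length to register `2`. -/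
def Prog.measure : Prog :=
  .loop 0 (.seq (.branch 0 .skip (.push 1 false) (.push 1 true)) (.seq (.pop 0) (.push 2 true)))

/-- Move register `1` to register `0`, marking every bit as in `encString`. -/
def Prog.markBits : Prog :=
  .loop 1 (.seq (.branch 1 .skip (.push 0 false) (.push 0 true)) (.seq (.push 0 true) (.pop 1)))

/-- The store while the instance is written. -/
def outStore (out y : List Bool) (n : ℕ) : Store :=
  Function.update (Function.update (Function.update (fun _ => []) 0 out) 1 y) 2
    (List.replicate n true)

lemma runs_measure (x : List Bool) :
    Prog.measure.Runs (initStore [x]) (outStore [] x.reverse x.length) (5 * x.length + 1) := by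
  have hloop := Prog.runs_loop_foldl (r := 0) (T := 4)
    (p := .seq (.branch 0 .skip (.push 1 false) (.push 1 true)) (.seq (.pop 0) (.push 2 true)))
    (fun (l m : List Bool) => outStore l m m.length) (fun m b => b :: m)
    (by simp [outStore]) (by simp [outStore])
    (fun b l m => by
      refine ((Prog.runs_branch_cons (b := b) (l := l) (a := 1)
        (s' := outStore (b :: l) (b :: m) m.length) (by simp [outStore]) ?_).seq
        ((Prog.runs_pop 0 _).seq (Prog.runs_push 2 true _))).congr rfl ?_ (by norm_num)
      · cases b
        · refine (Prog.runs_push 1 false _).congr rfl ?_ le_rfl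
          funext i; simp only [outStore, Function.update_apply]; split_ifs <;> simp_all
        · refine (Prog.runs_push 1 true _).congr rfl ?_ le_rfl
          funext i; simp only [outStore, Function.update_apply]; split_ifs <;> simp_all
      · funext i
        simp only [outStore, Function.update_apply, List.length_cons, List.replicate_succ]
        split_ifs <;> simp_all) x []
  have hfold : ∀ l m : List Bool, l.foldl (fun m b => b :: m) m = l.reverse ++ m := by
    intro l
    induction l with
    | nil => simp
    | cons b l ih => intro m; simp [ih]
  rw [hfold] at hloop
  refine hloop.congr ?_ (by simp) (by omega)
  funext i
  rcases i with _ | _ | _ | i <;> simp [initStore, outStore]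

/-- Register `1` holds `x` reversed, so pushing its bits restores their order. Each marker is pushed
after its bit and hence precedes it. -/
lemma runs_markBits (out x : List Bool) (n : ℕ) :
    Prog.markBits.Runs (outStore out x.reverse n)
      (outStore (x.flatMap (fun b => [true, b]) ++ out) [] n) (5 * x.length + 1) := by
  have hloop := Prog.runs_loop_foldl (r := 1) (T := 4)
    (p := .seq (.branch 1 .skip (.push 0 false) (.push 0 true)) (.seq (.push 0 true) (.pop 1)))
    (fun (l m : List Bool) => outStore m l n) (fun m b => true :: b :: m)
    (by simp [outStore]) (by simp [outStore])
    (fun b l m => by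
      refine ((Prog.runs_branch_cons (b := b) (l := l) (a := 1)
        (s' := outStore (b :: m) (b :: l) n) (by simp [outStore]) ?_).seq
        ((Prog.runs_push 0 true _).seq (Prog.runs_pop 1 _))).congr rfl ?_ (by norm_num)
      · cases b
        · refine (Prog.runs_push 0 false _).congr rfl ?_ le_rfl
          funext i; simp only [outStore, Function.update_apply]; split_ifs <;> simp_all
        · refine (Prog.runs_push 0 true _).congr rfl ?_ le_rfl
          funext i; simp only [outStore, Function.update_apply]; split_ifs <;> simp_all
      · funext i
        simp only [outStore, Function.update_apply]
        split_ifs <;> simp_all) x.reverse out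
  refine hloop.congr rfl ?_ (by simp; omega)
  clear hloop
  congr 1
  rw [List.foldl_reverse]
  induction x with
  | nil => rfl
  | cons b x ih => simp [ih]

lemma runs_pushList_outStore (l out y : List Bool) (n : ℕ) :
    (Prog.pushList 0 l).Runs (outStore out y n) (outStore (l ++ out) y n) (l.length + 1) := by
  refine (Prog.runs_pushList 0 l _).congr rfl ?_ le_rfl
  funext i
  simp only [outStore, Function.update_apply]
  split_ifs <;> simp_all

lemma exists_prog_polynomial_outStore (q : Polynomial ℕ) :
    ∃ (p : Prog) (τ : Polynomial ℕ), ∀ (out y : List Bool) (n : ℕ),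
      p.Runs (outStore out y n) (outStore (List.replicate (q.eval n) true ++ out) y n)
        (τ.eval n) := by
  obtain ⟨p, τ, h⟩ := exists_prog_polynomial q
  refine ⟨p, τ, fun out y n => (h n _ (by simp [outStore]) fun r hr => ?_).congr rfl ?_ le_rfl⟩
  · simp [outStore, show r ≠ 0 by omega, show r ≠ 1 by omega, show r ≠ 2 by omega]
  · funext i
    simp only [outStore, Function.update_apply]
    split_ifs <;> simp_all

lemma polyTime_instance_shape (a b : List Bool) (q B : Polynomial ℕ) :
    PolyTime fun x => a ++ (encUnary (q.eval x.length) ++ (encUnary (q.eval x.length) ++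
      (b ++ (encString x ++ encUnary (B.eval x.length))))) := by
  obtain ⟨pq, τq, hq⟩ := exists_prog_polynomial_outStore q
  obtain ⟨pB, τB, hB⟩ := exists_prog_polynomial_outStore B
  -- The output is written back to front, so each `false` is the end mark of the string or unary
  -- number pushed next; the one before `b` ends the second copy of `q`.
  refine ⟨.seq Prog.measure (.seq (Prog.pushList 0 [false]) (.seq pB (.seq (Prog.pushList 0 [false])
    (.seq Prog.markBits (.seq (Prog.pushList 0 (false :: b)) (.seq pq
    (.seq (Prog.pushList 0 [false]) (.seq pq (Prog.pushList 0 a))))))))),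
    5 * Polynomial.X + 1 + (2 + (τB + (2 + (5 * Polynomial.X + 1 +
      (Polynomial.C (b.length + 2) + (τq + (2 + (τq + Polynomial.C (a.length + 1))))))))),
    fun x => ?_⟩
  obtain ⟨t, ht, h⟩ := (runs_measure x).seq ((runs_pushList_outStore [false] _ _ _).seq
    ((hB _ _ _).seq ((runs_pushList_outStore [false] _ _ _).seq ((runs_markBits _ x _).seq
    ((runs_pushList_outStore (false :: b) _ _ _).seq ((hq _ _ _).seq
    ((runs_pushList_outStore [false] _ _ _).seq ((hq _ _ _).seq
    (runs_pushList_outStore a _ _ _)))))))))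
  refine ⟨_, t, ht.trans ?_, h, ?_⟩
  · simp
  · simp [outStore, encUnary, encString]

end Evac

/-! ### NP-hardness of EP -/

theorem mainTheorem2 : Evac.EP.NPHard := by
  rintro L ⟨verify, q, ⟨v, qv, hv⟩, hL⟩
  refine ⟨Evac.certificateInstance hv q, v.decider, Evac.behaviorBound q qv, ?_, fun x => ⟨?_, ?_⟩⟩
  -- The building, the start and the program depend only on `L`, so they are fixed strings. The
  -- polynomial `q + 1` is used twice because the deadline is the last time.
  · convert Evac.polyTime_instance_shape (Evac.encUnary 2 ++ Evac.encUnary 1)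
      (Evac.corridor.enc ++ Evac.encState Evac.corridorStart ++
        (Evac.Prog.behavior v (max 2 v.width)).enc) (q + 1) (Evac.behaviorBound q qv) using 2 with x
    simp [Evac.EP, Evac.EPInstance.enc, Evac.certificateInstance]
  · by_cases hx : ∃ c : List Bool, c.length ≤ q.eval x.length ∧ verify x c = [true]
    · obtain ⟨c, hc, hcv⟩ := hx
      obtain ⟨es, rfl⟩ := Evac.exists_ses_spelled_eq hc
      exact ⟨_, (Evac.certificateInstance_isAnswer hv q x _).2 ⟨es, fun _ => hcv, rfl⟩⟩
    -- Without a certificate every strong schedule is optimal, so any one will do.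
    · obtain ⟨es, -⟩ := Evac.exists_ses_spelled_eq (N := q.eval x.length) (c := []) (by simp)
      exact ⟨_, (Evac.certificateInstance_isAnswer hv q x _).2 ⟨es, fun h => (hx h).elim, rfl⟩⟩
  · intro y hy
    obtain ⟨es, hes, rfl⟩ := (Evac.certificateInstance_isAnswer hv q x y).1 hy
    refine ⟨_, Evac.decider_outputsWithin hv q x rfl es, ?_⟩
    rw [hL]
    exact ⟨hes, fun h => ⟨_, Evac.length_spelled_le es, h⟩⟩
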